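/- A cosymplectic manifold $(M,\eta,\omega)$ of dimension $2n+1$ is a smooth manifold (without boundary) with a smooth closed $1$-form $\eta$ and a smooth closed $2$-form $\omega$ such that $\eta\wedge\omega^n$ vanishes nowhere; its Reeb vector field $\xi$ is determined by $\eta(\xi)=1$, $\iota_\xi\omega=0$. Put $$H^1_{\mathrm{Reeb}}(M,\mathbb R)=\frac{\{\alpha\in\Omega^1(M): d\alpha=0,\ \alpha(\xi)\text{ constant}\}}{\{df: f\in C^\infty(M),\ \xi(f)\text{ constant}\}},$$ where "constant" means constant on each connected component. The flux group $\Gamma_{\eta,\omega}\subseteq H^1_{\mathrm{Reeb}}(M,\mathbb R)$ is the image of the flux homomorphism on the fundamental group of the group $G_{\eta,\omega}(M)$ of cosymplectomorphisms, i.e. the subgroup of all classes $$\widetilde S_{\eta,\omega}(\{\phi_t\})=\Bigl[\int_0^1\phi_t^*\bigl(\iota_{X_t}\omega+\eta(X_t)\,\eta\bigr)\,dt\Bigr],$$ where $\{\phi_t\}_{t\in[0,1]}$ runs over the smooth loops, $\phi_0=\phi_1=\mathrm{id}$, of diffeomorphisms of $M$ preserving $\eta$ and $\omega$, and $X_t$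 is the vector field generating $\phi_t$. Proposition. Let $(M_1,\eta_1,\omega_1)$ and $(M_2,\eta_2,\omega_2)$ be cosymplectic manifolds. Suppose there is a cosymplectomorphism $\phi:M_1\to M_2$, i.e. a diffeomorphism with $\phi^*\eta_2=\eta_1$ and $\phi^*\omega_2=\omega_1$. Then $[\alpha]\mapsto[\phi^*\alpha]$ is a well-defined linear isomorphism $$\phi^*:H^1_{\mathrm{Reeb}}(M_2,\mathbb R)\to H^1_{\mathrm{Reeb}}(M_1,\mathbb R),$$ it maps the subspace of classes having a representative with $\alpha(\xi_2)=0$ onto the subspace of classes having a representative with $\alpha(\xi_1)=0$, and it sends $\Gamma_{\eta_2,\omega_2}$ isomorphically onto $\Gamma_{\eta_1,\omega_1}$. In particular, if the groups $\Gamma_{\eta_1,\omega_1}$ and $\Gamma_{\eta_2,\omega_2}$ are not isomorphic, then there is no cosymplectomorphism between $(M_1,\eta_1,\omega_1)$ and $(M_2,\eta_2,\omega_2)$. -/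

import Mathlib

open Set
open scoped Topology

/-! ### Linear algebra of exterior products -/

/-- The exterior product of two real alternating forms:
`(a ∧ b)(v₁, …, vₖ₊ₗ)` is the sum over the `(k, l)`-shuffles `σ` of
`sign σ * a (v_{σ 1}, …, v_{σ k}) * b (v_{σ (k+1)}, …, v_{σ (k+l)})`. -/
noncomputable def wedgeAlt {V : Type*} [AddCommGroup V] [Module ℝ V] {k l : ℕ}
    (a : V [⋀^Fin k]→ₗ[ℝ] ℝ) (b : V [⋀^Fin l]→ₗ[ℝ] ℝ) : V [⋀^Fin (k + l)]→ₗ[ℝ] ℝ :=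
  ((LinearMap.mul' ℝ ℝ).compAlternatingMap (a.domCoprod b)).domDomCongr finSumFinEquiv

/-- The exterior power `ω ∧ ⋯ ∧ ω` (`n` factors) of a real alternating `2`-form. -/
noncomputable def wedgePowAlt {V : Type*} [AddCommGroup V] [Module ℝ V]
    (ω : V [⋀^Fin 2]→ₗ[ℝ] ℝ) : (n : ℕ) → V [⋀^Fin (2 * n)]→ₗ[ℝ] ℝ
  | 0 => AlternatingMap.constOfIsEmpty ℝ V (Fin 0) 1
  | n + 1 => wedgeAlt (wedgePowAlt ω n) ω

theorem wedgeAlt_apply_eq_zero {V : Type*} [AddCommGroup V] [Module ℝ V] {k l : ℕ}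
    {a : V [⋀^Fin k]→ₗ[ℝ] ℝ} {b : V [⋀^Fin l]→ₗ[ℝ] ℝ} {u : V}
    (ha : ∀ v i, v i = u → a v = 0) (hb : ∀ v i, v i = u → b v = 0)
    (v : Fin (k + l) → V) (i : Fin (k + l)) (hi : v i = u) : wedgeAlt a b v = 0 := by
  have key : ∀ σ : Equiv.Perm.ModSumCongr (Fin k) (Fin l),
      AlternatingMap.domCoprod.summand a b σ (v ∘ finSumFinEquiv) = 0 := by
    intro σ
    induction σ using Quotient.inductionOn' with
    | h σ =>
      rw [AlternatingMap.domCoprod.summand_mk'']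
      obtain ⟨j, rfl⟩ := (σ.trans finSumFinEquiv).surjective i
      rcases j with j | j
      · have := ha (fun i => v (finSumFinEquiv (σ (Sum.inl i)))) j hi
        simp [MultilinearMap.domDomCongr_apply, MultilinearMap.domCoprod_apply, this]
      · have := hb (fun i => v (finSumFinEquiv (σ (Sum.inr i)))) j hi
        simp [MultilinearMap.domDomCongr_apply, MultilinearMap.domCoprod_apply, this]
  have h2 : (a.domCoprod b) (v ∘ finSumFinEquiv) = 0 := by
    have := congrArg (fun f => f (v ∘ finSumFinEquiv)) (AlternatingMap.domCoprod_coe a b)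
    simp only [AlternatingMap.coe_multilinearMap, sum_apply, key,
      Finset.sum_const_zero] at this
    exact this
  change LinearMap.mul' ℝ ℝ ((a.domCoprod b) (v ∘ finSumFinEquiv)) = 0
  rw [h2, map_zero]

theorem wedgePowAlt_apply_eq_zero {V : Type*} [AddCommGroup V] [Module ℝ V]
    {ω : V [⋀^Fin 2]→ₗ[ℝ] ℝ} {u : V} (hω : ∀ v i, v i = u → ω v = 0) (n : ℕ) :
    ∀ (v : Fin (2 * n) → V) (i : Fin (2 * n)), v i = u → wedgePowAlt ω n v = 0 := by
  induction n with
  | zero => exact fun v i => i.elim0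
  | succ n ih => exact wedgeAlt_apply_eq_zero ih hω

theorem alternating_eq_zero_of_kernel {V : Type*} [AddCommGroup V] [Module ℝ V] {N : ℕ}
    (hN : Module.finrank ℝ V = N) (hN0 : 0 < N) {W : V [⋀^Fin N]→ₗ[ℝ] ℝ} {u : V} (hu : u ≠ 0)
    (hW : ∀ v i, v i = u → W v = 0) : W = 0 := by
  ext v
  by_cases hv : LinearIndependent ℝ v
  · have : Nonempty (Fin N) := ⟨⟨0, hN0⟩⟩
    let b := basisOfLinearIndependentOfCardEqFinrank hv (by simp [hN])
    have hb : ∀ i, b i = v i := fun i => by simp [b]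
    obtain ⟨j, hj⟩ : ∃ j, b.repr u j ≠ 0 := by
      by_contra! h
      exact hu (b.repr.map_eq_zero_iff.mp (Finsupp.ext h))
    have h1 : W (Function.update v j u) = 0 := hW _ j (by simp)
    have h2 : W (Function.update v j u) = b.repr u j * W v := by
      conv_lhs => rw [← b.sum_repr u]
      rw [W.map_update_sum, Finset.sum_eq_single j]
      · rw [W.map_update_smul, hb, Function.update_eq_self, smul_eq_mul]
      · intro i _ hij
        rw [W.map_update_smul, hb, W.map_update_self _ hij.symm, smul_zero]
      · simp
    rw [h1] at h2
    simpa [hj] using h2.symm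
  · simpa using W.map_linearDependent v hv

theorem pair_eq_cons {V : Type*} (v : Fin 2 → V) : v = ![v 0, v 1] := by
  ext i; fin_cases i <;> rfl

theorem alternating_two_swap {V : Type*} [AddCommGroup V] [Module ℝ V]
    (ω : V [⋀^Fin 2]→ₗ[ℝ] ℝ) (u w : V) : ω ![u, w] = - ω ![w, u] := by
  have := ω.map_swap ![w, u] (i := 0) (j := 1) (by decide)
  rw [← this]
  congr 1
  ext i; fin_cases i <;> simp

theorem kernel_eq_zero_of_volume {V : Type*} [AddCommGroup V] [Module ℝ V] {n : ℕ}
    (hV : Module.finrank ℝ V = 2 * n + 1) {η : V [⋀^Fin 1]→ₗ[ℝ] ℝ} {ω : V [⋀^Fin 2]→ₗ[ℝ] ℝ}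
    (h : wedgeAlt η (wedgePowAlt ω n) ≠ 0) {u : V} (h1 : η (fun _ => u) = 0)
    (h2 : ∀ w, ω ![u, w] = 0) : u = 0 := by
  by_contra hu
  refine h (alternating_eq_zero_of_kernel (by omega) (by omega) hu
    (wedgeAlt_apply_eq_zero ?_ (wedgePowAlt_apply_eq_zero ?_ n)))
  · intro v i hi
    have : v = fun _ => u := by
      ext j; rw [Subsingleton.elim j i, hi]
    rw [this, h1]
  · intro v i hi
    rw [pair_eq_cons v]
    fin_cases i
    · have : v 0 = u := hi
      rw [this, h2]
    · have : v 1 = u := hi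
      rw [this, alternating_two_swap, h2, neg_zero]

/-- An alternating `2`-form on an odd-dimensional space is degenerate. -/
theorem exists_kernel_of_odd {V : Type*} [AddCommGroup V] [Module ℝ V] {n : ℕ}
    (hV : Module.finrank ℝ V = 2 * n + 1) (ω : V [⋀^Fin 2]→ₗ[ℝ] ℝ) :
    ∃ u : V, u ≠ 0 ∧ ∀ w, ω ![u, w] = 0 := by
  have : Module.Finite ℝ V := Module.finite_of_finrank_pos (by omega)
  let b := Module.finBasisOfFinrankEq ℝ V hV
  let A : Matrix (Fin (2 * n + 1)) (Fin (2 * n + 1)) ℝ := fun i j => ω ![b j, b i]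
  have hA : A.transpose = -A := by
    ext i j
    exact alternating_two_swap ω _ _
  have hdet : A.det = 0 := by
    have h := congrArg Matrix.det hA
    rw [Matrix.det_transpose, Matrix.det_neg, Fintype.card_fin, pow_succ, pow_mul] at h
    norm_num at h
    linarith
  obtain ⟨c, hc, hAc⟩ := Matrix.exists_mulVec_eq_zero_iff.mpr hdet
  let u := ∑ j, c j • b j
  have add1 : ∀ x y w, ω ![x + y, w] = ω ![x, w] + ω ![y, w] := fun x y w => by
    exact ω.map_vecCons_add ![w] x y
  have smul1 : ∀ (r : ℝ) x w, ω ![r • x, w] = r * ω ![x, w] := fun r x w => by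
    exact ω.map_vecCons_smul ![w] r x
  let B : V → V →ₗ[ℝ] ℝ := fun w =>
    { toFun := fun x => ω ![x, w], map_add' := fun x y => add1 x y w,
      map_smul' := fun r x => smul1 r x w }
  refine ⟨u, ?_, ?_⟩
  · intro hu
    apply hc
    ext j
    exact Fintype.linearIndependent_iff.mp b.linearIndependent c hu j
  · have hb : ∀ i, ω ![u, b i] = 0 := by
      intro i
      have h1 : ω ![u, b i] = ∑ j, c j * ω ![b j, b i] := by
        change B (b i) u = _
        simp only [u, map_sum, map_smul, smul_eq_mul]
        rfl
      rw [h1]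
      have h2 := congrFun hAc i
      simp only [Matrix.mulVec, dotProduct, A, Pi.zero_apply] at h2
      rw [← h2]
      exact Finset.sum_congr rfl fun j _ => mul_comm _ _
    intro w
    rw [alternating_two_swap, neg_eq_zero]
    change B u w = 0
    have : B u = 0 := b.ext fun i => by
      change ω ![b i, u] = 0
      rw [alternating_two_swap, hb, neg_zero]
    rw [this]; rfl

/-- If `η ∧ ωⁿ` is a nonzero top-degree form, there is exactly one vector `v` with
`η(v) = 1` and `ι_v ω = 0`. -/
theorem existsUnique_reeb {V : Type*} [AddCommGroup V] [Module ℝ V] {n : ℕ}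
    (hV : Module.finrank ℝ V = 2 * n + 1) {η : V [⋀^Fin 1]→ₗ[ℝ] ℝ} {ω : V [⋀^Fin 2]→ₗ[ℝ] ℝ}
    (h : wedgeAlt η (wedgePowAlt ω n) ≠ 0) :
    ∃! v : V, η (fun _ => v) = 1 ∧ ∀ w, ω ![v, w] = 0 := by
  let L : V →ₗ[ℝ] ℝ := (AlternatingMap.ofSubsingleton ℝ V ℝ (0 : Fin 1)).symm η
  have hL : ∀ v, η (fun _ => v) = L v := fun v => by
    rfl
  obtain ⟨u, hu, hω⟩ := exists_kernel_of_odd hV ω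
  have hηu : η (fun _ => u) ≠ 0 := fun h0 => hu (kernel_eq_zero_of_volume hV h h0 hω)
  have smul1 : ∀ (r : ℝ) x w, ω ![r • x, w] = r * ω ![x, w] := fun r x w => by
    exact ω.map_vecCons_smul ![w] r x
  have sub1 : ∀ x y w, ω ![x - y, w] = ω ![x, w] - ω ![y, w] := fun x y w => by
    have h1 : ω ![(x - y) + y, w] = ω ![x - y, w] + ω ![y, w] := by
      exact ω.map_vecCons_add ![w] (x - y) y
    rw [sub_add_cancel] at h1
    linarith
  refine ⟨(L u)⁻¹ • u, ⟨?_, ?_⟩, ?_⟩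
  · rw [hL, map_smul, smul_eq_mul]
    exact inv_mul_cancel₀ (by rwa [hL] at hηu)
  · intro w; rw [smul1, hω, mul_zero]
  · rintro v ⟨hv1, hv2⟩
    rw [← sub_eq_zero]
    refine kernel_eq_zero_of_volume hV h ?_ ?_
    · rw [hL, map_sub, map_smul, smul_eq_mul, inv_mul_cancel₀ (by rwa [hL] at hηu), ← hL, hv1,
        sub_self]
    · intro w; rw [sub1, smul1, hv2, hω]; simp

/-! ### Differential forms on manifolds without boundary -/

open scoped Manifold

/-- The order of differentiability `∞` (smooth, not analytic). -/
local notation "C∞" => ((⊤ : ℕ∞) : WithTop ℕ∞)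

section Forms

variable {d e : ℕ}
  {M : Type*} [TopologicalSpace M] [ChartedSpace (EuclideanSpace ℝ (Fin d)) M]
  {N : Type*} [TopologicalSpace N] [ChartedSpace (EuclideanSpace ℝ (Fin e)) N]

/-- Real `k`-forms on a `d`-dimensional manifold `M`, as families of alternating forms on the
tangent spaces; smoothness is the separate predicate `DiffForm.IsSmooth`. -/
def DiffForm (d : ℕ) (M : Type*) [TopologicalSpace M]
    [ChartedSpace (EuclideanSpace ℝ (Fin d)) M] (k : ℕ) : Type _ :=
  ∀ x : M, TangentSpace (𝓡 d) x [⋀^Fin k]→L[ℝ] ℝ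

noncomputable instance (k : ℕ) : AddCommGroup (DiffForm d M k) :=
  inferInstanceAs (AddCommGroup (∀ x : M, TangentSpace (𝓡 d) x [⋀^Fin k]→L[ℝ] ℝ))

noncomputable instance (k : ℕ) : Module ℝ (DiffForm d M k) :=
  inferInstanceAs (Module ℝ (∀ x : M, TangentSpace (𝓡 d) x [⋀^Fin k]→L[ℝ] ℝ))

/-- The expression of a form in the preferred chart at `x₀`: its pullback by the inverse chart. -/
noncomputable def DiffForm.inChart {k : ℕ} (α : DiffForm d M k) (x₀ : M) :
    EuclideanSpace ℝ (Fin d) → EuclideanSpace ℝ (Fin d) [⋀^Fin k]→L[ℝ] ℝ := fun y =>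
  (α ((extChartAt (𝓡 d) x₀).symm y)).compContinuousLinearMap
    (mfderiv 𝓘(ℝ, EuclideanSpace ℝ (Fin d)) (𝓡 d) (extChartAt (𝓡 d) x₀).symm y)

/-- A form is smooth if, around every point, its expression in the chart is smooth. -/
def DiffForm.IsSmooth {k : ℕ} (α : DiffForm d M k) : Prop :=
  ∀ x : M, ContDiffAt ℝ C∞ (α.inChart x) (extChartAt (𝓡 d) x x)

/-- The exterior derivative of a (smooth) form, computed at each point in the chart there. -/
noncomputable def DiffForm.extD {k : ℕ} (α : DiffForm d M k) : DiffForm d M (k + 1) := fun x =>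
  (extDeriv (α.inChart x) (extChartAt (𝓡 d) x x)).compContinuousLinearMap
    (mfderiv (𝓡 d) 𝓘(ℝ, EuclideanSpace ℝ (Fin d)) (extChartAt (𝓡 d) x) x)

/-- The pullback of a form by a map. -/
noncomputable def DiffForm.pullback {k : ℕ} (f : M → N) (α : DiffForm e N k) : DiffForm d M k :=
  fun x => (α (f x)).compContinuousLinearMap (mfderiv (𝓡 d) (𝓡 e) f x)

/-- The differential `df` of a function, as a `1`-form. -/
noncomputable def DiffForm.dFun (f : M → ℝ) : DiffForm d M 1 := fun x =>
  ContinuousAlternatingMap.ofSubsingleton ℝ (TangentSpace (𝓡 d) x) ℝ (0 : Fin 1)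
    (mfderiv (𝓡 d) 𝓘(ℝ, ℝ) f x)

theorem DiffForm.inChart_add {k : ℕ} (α β : DiffForm d M k) (x : M) :
    (α + β).inChart x = α.inChart x + β.inChart x := by
  ext y v; rfl

theorem DiffForm.inChart_smul {k : ℕ} (c : ℝ) (α : DiffForm d M k) (x : M) :
    (c • α).inChart x = c • α.inChart x := by
  ext y v; rfl

theorem DiffForm.inChart_zero {k : ℕ} (x : M) :
    (0 : DiffForm d M k).inChart x = 0 := by
  ext y v; rfl

theorem DiffForm.IsSmooth.add {k : ℕ} {α β : DiffForm d M k} (hα : α.IsSmooth)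
    (hβ : β.IsSmooth) : (α + β).IsSmooth := fun x => by
  rw [DiffForm.inChart_add]; exact (hα x).add (hβ x)

theorem DiffForm.IsSmooth.smul {k : ℕ} {α : DiffForm d M k} (c : ℝ) (hα : α.IsSmooth) :
    (c • α).IsSmooth := fun x => by
  rw [DiffForm.inChart_smul]; exact contDiffAt_const.smul (hα x)

theorem DiffForm.isSmooth_zero {k : ℕ} : (0 : DiffForm d M k).IsSmooth := fun x => by
  rw [DiffForm.inChart_zero]; exact contDiffAt_const

theorem DiffForm.extD_add {k : ℕ} {α β : DiffForm d M k} (hα : α.IsSmooth)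
    (hβ : β.IsSmooth) : (α + β).extD = α.extD + β.extD := by
  funext x
  unfold DiffForm.extD
  rw [DiffForm.inChart_add, extDeriv_add ((hα x).differentiableAt (by simp))
    ((hβ x).differentiableAt (by simp))]
  ext v; rfl

theorem DiffForm.extD_smul {k : ℕ} (c : ℝ) (α : DiffForm d M k) :
    (c • α).extD = c • α.extD := by
  funext x
  unfold DiffForm.extD
  rw [DiffForm.inChart_smul, extDeriv_smul]
  ext v; rfl

theorem DiffForm.extD_zero {k : ℕ} : (0 : DiffForm d M k).extD = 0 := by
  simpa using DiffForm.extD_smul (0 : ℝ) (0 : DiffForm d M k)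

theorem DiffForm.dFun_apply (f : M → ℝ) (x : M) (v : TangentSpace (𝓡 d) x) :
    DiffForm.dFun f x (fun _ => v) = mfderiv (𝓡 d) 𝓘(ℝ, ℝ) f x v := rfl

theorem DiffForm.dFun_add {f g : M → ℝ} (hf : ContMDiff (𝓡 d) 𝓘(ℝ, ℝ) C∞ f)
    (hg : ContMDiff (𝓡 d) 𝓘(ℝ, ℝ) C∞ g) :
    (DiffForm.dFun (f + g) : DiffForm d M 1) = DiffForm.dFun f + DiffForm.dFun g := by
  funext x
  unfold DiffForm.dFun
  rw [mfderiv_add ((hf x).mdifferentiableAt (by simp)) ((hg x).mdifferentiableAt (by simp))]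
  ext v; rfl

theorem DiffForm.dFun_smul {f : M → ℝ} (c : ℝ) (hf : ContMDiff (𝓡 d) 𝓘(ℝ, ℝ) C∞ f) :
    (DiffForm.dFun (c • f) : DiffForm d M 1) = c • DiffForm.dFun f := by
  funext x
  unfold DiffForm.dFun
  rw [const_smul_mfderiv ((hf x).mdifferentiableAt (by simp))]
  ext v; rfl

end Forms

/-! ### Cosymplectic manifolds and the Reeb cohomology -/

/-- A cosymplectic structure on a `(2n+1)`-dimensional manifold: a smooth closed `1`-form `η` and
a smooth closed `2`-form `ω` such that `η ∧ ωⁿ` is a volume form (vanishes nowhere). -/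
structure CosymplecticStructure (n : ℕ) (M : Type*) [TopologicalSpace M]
    [ChartedSpace (EuclideanSpace ℝ (Fin (2 * n + 1))) M]
    [IsManifold (𝓡 (2 * n + 1)) C∞ M] where
  η : DiffForm (2 * n + 1) M 1
  ω : DiffForm (2 * n + 1) M 2
  smooth_η : η.IsSmooth
  smooth_ω : ω.IsSmooth
  closed_η : η.extD = 0
  closed_ω : ω.extD = 0
  volume : ∀ x : M,
    wedgeAlt (η x).toAlternatingMap (wedgePowAlt (ω x).toAlternatingMap n) ≠ 0

namespace CosymplecticStructure

section Reeb

variable {n : ℕ} {M : Type*} [TopologicalSpace M]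
  [ChartedSpace (EuclideanSpace ℝ (Fin (2 * n + 1))) M] [IsManifold (𝓡 (2 * n + 1)) C∞ M]
  (S : CosymplecticStructure n M)

theorem existsUnique_reebVector (x : M) :
    ∃! v : TangentSpace (𝓡 (2 * n + 1)) x,
      S.η x (fun _ => v) = 1 ∧ ∀ w : TangentSpace (𝓡 (2 * n + 1)) x, S.ω x ![v, w] = 0 :=
  existsUnique_reeb (V := TangentSpace (𝓡 (2 * n + 1)) x)
    (finrank_euclideanSpace_fin (𝕜 := ℝ) (n := 2 * n + 1)) (S.volume x)

/-- The Reeb vector field `ξ`, determined by `η(ξ) = 1` and `ι_ξ ω = 0`. -/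
noncomputable def reeb (x : M) : TangentSpace (𝓡 (2 * n + 1)) x :=
  (S.existsUnique_reebVector x).choose

theorem reeb_spec (x : M) :
    S.η x (fun _ => S.reeb x) = 1 ∧
      ∀ w : TangentSpace (𝓡 (2 * n + 1)) x, S.ω x ![S.reeb x, w] = 0 :=
  (S.existsUnique_reebVector x).choose_spec.1

theorem eq_reeb {x : M} {v : TangentSpace (𝓡 (2 * n + 1)) x} (h1 : S.η x (fun _ => v) = 1)
    (h2 : ∀ w : TangentSpace (𝓡 (2 * n + 1)) x, S.ω x ![v, w] = 0) : v = S.reeb x :=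
  (S.existsUnique_reebVector x).choose_spec.2 v ⟨h1, h2⟩

/-- The smooth functions `f` such that `ξ(f)` is constant (on each connected component). -/
def C0Reeb : Submodule ℝ (M → ℝ) where
  carrier := {f | ContMDiff (𝓡 (2 * n + 1)) 𝓘(ℝ, ℝ) C∞ f ∧
    IsLocallyConstant fun x => DiffForm.dFun f x fun _ => S.reeb x}
  add_mem' {f g} hf hg := by
    refine ⟨hf.1.add hg.1, ?_⟩
    rw [DiffForm.dFun_add hf.1 hg.1]
    exact hf.2.add hg.2
  zero_mem' := by
    refine ⟨contMDiff_const, ?_⟩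
    have h : (DiffForm.dFun (0 : M → ℝ) : DiffForm (2 * n + 1) M 1) = 0 := by
      simpa using DiffForm.dFun_smul (d := 2 * n + 1) (0 : ℝ)
        (f := (0 : M → ℝ)) contMDiff_const
    rw [h]
    exact IsLocallyConstant.const 0
  smul_mem' c f hf := by
    refine ⟨(contMDiff_const (c := c)).mul hf.1, ?_⟩
    rw [DiffForm.dFun_smul c hf.1]
    exact hf.2.comp (fun r => c • r)

/-- The smooth closed `1`-forms `α` such that `α(ξ)` is constant (on each connected component). -/
def C1Reeb : Submodule ℝ (DiffForm (2 * n + 1) M 1) where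
  carrier := {α | α.IsSmooth ∧ α.extD = 0 ∧ IsLocallyConstant fun x => α x fun _ => S.reeb x}
  add_mem' {α β} hα hβ :=
    ⟨hα.1.add hβ.1, by rw [DiffForm.extD_add hα.1 hβ.1, hα.2.1, hβ.2.1, add_zero],
      hα.2.2.add hβ.2.2⟩
  zero_mem' := ⟨DiffForm.isSmooth_zero, DiffForm.extD_zero, IsLocallyConstant.const 0⟩
  smul_mem' c α hα :=
    ⟨hα.1.smul c, by rw [DiffForm.extD_smul, hα.2.1, smul_zero], hα.2.2.comp (fun r => c • r)⟩

/-- The differential `d` on `C0Reeb`. -/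
noncomputable def dReeb : S.C0Reeb →ₗ[ℝ] DiffForm (2 * n + 1) M 1 where
  toFun f := DiffForm.dFun (f : M → ℝ)
  map_add' f g := DiffForm.dFun_add f.2.1 g.2.1
  map_smul' c f := DiffForm.dFun_smul c f.2.1

/-- The image of `d : C0Reeb → C1Reeb`. -/
noncomputable def B1Reeb : Submodule ℝ S.C1Reeb :=
  (LinearMap.range S.dReeb).comap S.C1Reeb.subtype

/-- The Reeb cohomology `H¹_Reeb(M, ℝ) = C1Reeb / d C0Reeb`. -/
abbrev H1Reeb : Type _ := S.C1Reeb ⧸ S.B1Reeb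

/-- The cohomology class in `H¹_Reeb(M, ℝ)` of a `1`-form in `C1Reeb`. -/
noncomputable abbrev classOf (α : S.C1Reeb) : S.H1Reeb := Submodule.Quotient.mk α

/-- The subspace of `H¹_Reeb(M, ℝ)` of the classes `[α]` with `α(ξ) = 0`. -/
noncomputable def H1ReebHorizontal : Submodule ℝ S.H1Reeb :=
  Submodule.map S.B1Reeb.mkQ
    { carrier := {α : S.C1Reeb | ∀ x, (α : DiffForm (2 * n + 1) M 1) x (fun _ => S.reeb x) = 0}
      add_mem' := fun {α β} hα hβ x => by
        change (α : DiffForm (2 * n + 1) M 1) x _ + (β : DiffForm (2 * n + 1) M 1) x _ = 0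
        rw [hα x, hβ x, add_zero]
      zero_mem' := fun _ => rfl
      smul_mem' := fun c α hα x => by
        change c • (α : DiffForm (2 * n + 1) M 1) x _ = 0
        rw [hα x, smul_zero] }

end Reeb

/-! ### Cosymplectic isotopies and the flux group -/

/-- A cosymplectomorphism `φ : (M₁, η₁, ω₁) → (M₂, η₂, ω₂)`: a diffeomorphism with
`φ^* η₂ = η₁` and `φ^* ω₂ = ω₁`. -/
def IsCosymplectomorphism {n₁ n₂ : ℕ} {M₁ M₂ : Type*}
    [TopologicalSpace M₁] [ChartedSpace (EuclideanSpace ℝ (Fin (2 * n₁ + 1))) M₁]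
    [IsManifold (𝓡 (2 * n₁ + 1)) C∞ M₁]
    [TopologicalSpace M₂] [ChartedSpace (EuclideanSpace ℝ (Fin (2 * n₂ + 1))) M₂]
    [IsManifold (𝓡 (2 * n₂ + 1)) C∞ M₂]
    (S₁ : CosymplecticStructure n₁ M₁) (S₂ : CosymplecticStructure n₂ M₂)
    (φ : Diffeomorph (𝓡 (2 * n₁ + 1)) (𝓡 (2 * n₂ + 1)) M₁ M₂ C∞) : Prop :=
  DiffForm.pullback φ S₂.η = S₁.η ∧ DiffForm.pullback φ S₂.ω = S₁.ω

section Flux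

variable {n : ℕ} {M : Type*} [TopologicalSpace M]
  [ChartedSpace (EuclideanSpace ℝ (Fin (2 * n + 1))) M] [IsManifold (𝓡 (2 * n + 1)) C∞ M]
  (S : CosymplecticStructure n M)

/-- A cosymplectic isotopy `(φ_t)`, `t ∈ [0, 1]`: a family of cosymplectomorphisms of `M`,
jointly smooth on `[0, 1] × M`, with `φ_0 = id`. Values for `t ∉ [0, 1]` are irrelevant. -/
structure IsCosymplecticIsotopy (Φ : ℝ → M → M) : Prop where
  smooth : ContMDiffOn (𝓘(ℝ, ℝ).prod (𝓡 (2 * n + 1))) (𝓡 (2 * n + 1)) C∞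
    (fun p : ℝ × M => Φ p.1 p.2) (Icc 0 1 ×ˢ univ)
  map_zero : Φ 0 = id
  cosymplectic : ∀ t ∈ Icc (0 : ℝ) 1,
    ∃ ψ : Diffeomorph (𝓡 (2 * n + 1)) (𝓡 (2 * n + 1)) M M C∞, ⇑ψ = Φ t ∧ IsCosymplectomorphism S S ψ

/-- A (smooth) loop of cosymplectomorphisms based at the identity. -/
def IsCosymplecticLoop (Φ : ℝ → M → M) : Prop :=
  IsCosymplecticIsotopy S Φ ∧ Φ 1 = id

/-- The velocity `d/dt φ_t(x)`, a tangent vector at `φ_t(x)`; it is the value at `φ_t(x)` of the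
generating time-dependent vector field. -/
noncomputable def isotopyVelocity {d : ℕ} {M : Type*} [TopologicalSpace M]
    [ChartedSpace (EuclideanSpace ℝ (Fin d)) M] (Φ : ℝ → M → M) (t : ℝ) (x : M) :
    TangentSpace (𝓡 d) (Φ t x) :=
  mfderivWithin 𝓘(ℝ, ℝ) (𝓡 d) (fun s => Φ s x) (Icc 0 1) t (1 : ℝ)

/-- For the isotopy `(φ_t)` generated by `X_t`, the value on a tangent vector `v` at `x` of the
`1`-form `φ_t^* (ι_{X_t} ω + η(X_t) η)`. -/
noncomputable def fluxIntegrand (Φ : ℝ → M → M) (x : M) (v : TangentSpace (𝓡 (2 * n + 1)) x)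
    (t : ℝ) : ℝ :=
  S.ω (Φ t x) ![isotopyVelocity Φ t x, mfderiv (𝓡 (2 * n + 1)) (𝓡 (2 * n + 1)) (Φ t) x v] +
    S.η (Φ t x) (fun _ => isotopyVelocity Φ t x) *
      S.η (Φ t x) (fun _ => mfderiv (𝓡 (2 * n + 1)) (𝓡 (2 * n + 1)) (Φ t) x v)

/-- `α` is the flux form `∫₀¹ φ_t^* (ι_{X_t} ω + η(X_t) η) dt` of the isotopy `(φ_t)`. -/
def IsFluxForm (Φ : ℝ → M → M) (α : DiffForm (2 * n + 1) M 1) : Prop :=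
  ∀ (x : M) (v : TangentSpace (𝓡 (2 * n + 1)) x),
    IntervalIntegrable (fluxIntegrand S Φ x v) MeasureTheory.volume 0 1 ∧
      α x (fun _ => v) = ∫ t in (0 : ℝ)..1, fluxIntegrand S Φ x v t

theorem IsCosymplecticIsotopy.mdifferentiableWithinAt {S : CosymplecticStructure n M}
    {Φ : ℝ → M → M} (h : IsCosymplecticIsotopy S Φ) (x : M) {t : ℝ} (ht : t ∈ Icc (0 : ℝ) 1) :
    MDifferentiableWithinAt 𝓘(ℝ, ℝ) (𝓡 (2 * n + 1)) (fun s => Φ s x) (Icc 0 1) t := by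
  have h1 : ContMDiffOn 𝓘(ℝ, ℝ) (𝓘(ℝ, ℝ).prod (𝓡 (2 * n + 1))) C∞ (fun s : ℝ => (s, x))
      (Icc 0 1) := (contMDiff_id.prodMk contMDiff_const).contMDiffOn
  have h2 := h.smooth.comp h1 (fun s hs => ⟨hs, mem_univ _⟩)
  exact (h2 t ht).mdifferentiableWithinAt (by simp)

theorem fluxIntegrand_smul_of_velocity {Φ Θ : ℝ → M → M} {x : M}
    {v : TangentSpace (𝓡 (2 * n + 1)) x} {t s c : ℝ} (h : Θ t = Φ s)
    (hv : (isotopyVelocity Θ t x : EuclideanSpace ℝ (Fin (2 * n + 1))) =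
      c • (isotopyVelocity Φ s x : EuclideanSpace ℝ (Fin (2 * n + 1)))) :
    fluxIntegrand S Θ x v t = c * fluxIntegrand S Φ x v s := by
  have key : ∀ (f g : M → M) (_ : f = g) (u u' : EuclideanSpace ℝ (Fin (2 * n + 1)))
      (_ : u = c • u'),
      S.ω (f x) ![(u : TangentSpace (𝓡 (2 * n + 1)) (f x)),
          mfderiv (𝓡 (2 * n + 1)) (𝓡 (2 * n + 1)) f x v] +
        S.η (f x) (fun _ => (u : TangentSpace (𝓡 (2 * n + 1)) (f x))) *
          S.η (f x) (fun _ => mfderiv (𝓡 (2 * n + 1)) (𝓡 (2 * n + 1)) f x v) =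
      c * (S.ω (g x) ![(u' : TangentSpace (𝓡 (2 * n + 1)) (g x)),
          mfderiv (𝓡 (2 * n + 1)) (𝓡 (2 * n + 1)) g x v] +
        S.η (g x) (fun _ => (u' : TangentSpace (𝓡 (2 * n + 1)) (g x))) *
          S.η (g x) (fun _ => mfderiv (𝓡 (2 * n + 1)) (𝓡 (2 * n + 1)) g x v)) := by
    rintro f _ rfl _ u' rfl
    have e1 : ∀ w : TangentSpace (𝓡 (2 * n + 1)) (f x),
        S.ω (f x) ![c • (u' : TangentSpace (𝓡 (2 * n + 1)) (f x)), w] =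
          c * S.ω (f x) ![(u' : TangentSpace (𝓡 (2 * n + 1)) (f x)), w] := fun w =>
      (S.ω (f x)).toAlternatingMap.map_vecCons_smul ![w] c u'
    have e2 : S.η (f x) (fun _ => c • (u' : TangentSpace (𝓡 (2 * n + 1)) (f x))) =
        c * S.η (f x) (fun _ => (u' : TangentSpace (𝓡 (2 * n + 1)) (f x))) := by
      exact map_smul ((AlternatingMap.ofSubsingleton ℝ
        (TangentSpace (𝓡 (2 * n + 1)) (f x)) ℝ (0 : Fin 1)).symm (S.η (f x)).toAlternatingMap) c u'
    refine (congrArg₂ (fun a b => a + b * _) (e1 _) e2).trans ?_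
    ring
  exact key _ _ h _ _ hv

theorem fluxIntegrand_reparam {S : CosymplecticStructure n M} {Φ Θ : ℝ → M → M}
    (hΦ : IsCosymplecticIsotopy S Φ) {a : ℝ → ℝ} {a' t : ℝ} (ht : t ∈ Icc (0 : ℝ) 1)
    (ha : HasDerivAt a a' t) (ham : ∀ s ∈ Icc (0 : ℝ) 1, a s ∈ Icc (0 : ℝ) 1)
    (h : ∀ᶠ s in 𝓝 t, Θ s = Φ (a s)) (x : M) (v : TangentSpace (𝓡 (2 * n + 1)) x) :
    fluxIntegrand S Θ x v t = a' * fluxIntegrand S Φ x v (a t) := by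
  refine fluxIntegrand_smul_of_velocity S h.self_of_nhds ?_
  have hu : UniqueMDiffWithinAt 𝓘(ℝ, ℝ) (Icc (0 : ℝ) 1) t :=
    (uniqueDiffOn_Icc (zero_lt_one' ℝ) t ht).uniqueMDiffWithinAt
  have h1 : mfderivWithin 𝓘(ℝ, ℝ) (𝓡 (2 * n + 1)) (fun s => Θ s x) (Icc 0 1) t =
      mfderivWithin 𝓘(ℝ, ℝ) (𝓡 (2 * n + 1)) ((fun s => Φ s x) ∘ a) (Icc 0 1) t := by
    refine Filter.EventuallyEq.mfderivWithin_eq_of_mem ?_ ht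
    exact (h.mono fun s hs => congrFun hs x).filter_mono nhdsWithin_le_nhds
  have hda : HasMFDerivWithinAt 𝓘(ℝ, ℝ) 𝓘(ℝ, ℝ) a (Icc 0 1) t
      (ContinuousLinearMap.toSpanSingleton ℝ a') :=
    ha.hasFDerivAt.hasMFDerivAt.hasMFDerivWithinAt
  have h2 := mfderivWithin_comp t (hΦ.mdifferentiableWithinAt x (ham t ht))
    hda.mdifferentiableWithinAt (fun s hs => ham s hs) hu
  rw [hda.mfderivWithin hu] at h2
  have h3 := h1.trans h2
  have h4 := congrArg (fun L : ℝ →L[ℝ] EuclideanSpace ℝ (Fin (2 * n + 1)) => L 1) h3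
  refine h4.trans ?_
  change mfderivWithin 𝓘(ℝ, ℝ) (𝓡 (2 * n + 1)) (fun s => Φ s x) (Icc 0 1) (a t)
    ((1 : ℝ) • a') = _
  have h5 : ((1 : ℝ) • a' : ℝ) = a' • (1 : ℝ) := by simp
  rw [h5]
  exact (mfderivWithin 𝓘(ℝ, ℝ) (𝓡 (2 * n + 1)) (fun s => Φ s x) (Icc 0 1) (a t)).map_smul a' 1

theorem fluxIntegrand_const (x : M) (v : TangentSpace (𝓡 (2 * n + 1)) x) (t : ℝ) :
    fluxIntegrand S (fun _ => id) x v t = 0 := by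
  have h := fluxIntegrand_smul_of_velocity S (Φ := fun _ => id) (Θ := fun _ => id) (x := x)
    (v := v) (t := t) (s := t) (c := 0) rfl (by
      have h0 : mfderivWithin 𝓘(ℝ, ℝ) (𝓡 (2 * n + 1)) (fun _ : ℝ => x) (Icc 0 1) t = 0 :=
        mfderivWithin_const
      have h1 := congrArg (fun L : ℝ →L[ℝ] EuclideanSpace ℝ (Fin (2 * n + 1)) => L 1) h0
      rw [zero_smul]
      exact h1)
  rw [h, zero_mul]

theorem isCosymplecticLoop_const : IsCosymplecticLoop S (fun _ => id) := by
  refine ⟨⟨contMDiff_snd.contMDiffOn, rfl, fun t _ => ⟨Diffeomorph.refl _ M _, rfl, ?_⟩⟩, rfl⟩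
  constructor
  all_goals
    funext x
    ext v
    simp [DiffForm.pullback]
    rfl

theorem isFluxForm_const : IsFluxForm S (fun _ => id) 0 := by
  intro x v
  have : fluxIntegrand S (fun _ => id) x v = fun _ => 0 :=
    funext fun t => fluxIntegrand_const S x v t
  rw [this]
  exact ⟨intervalIntegrable_const, by simp; rfl⟩

theorem IsCosymplecticLoop.reverse {S : CosymplecticStructure n M} {Φ : ℝ → M → M}
    (h : IsCosymplecticLoop S Φ) : IsCosymplecticLoop S (fun t => Φ (1 - t)) := by
  refine ⟨⟨?_, ?_, ?_⟩, ?_⟩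
  · have h1 : ContMDiffOn (𝓘(ℝ, ℝ).prod (𝓡 (2 * n + 1))) (𝓘(ℝ, ℝ).prod (𝓡 (2 * n + 1))) C∞
        (fun p : ℝ × M => (1 - p.1, p.2)) (Icc 0 1 ×ˢ univ) :=
      ((contMDiff_const.sub contMDiff_fst).prodMk contMDiff_snd).contMDiffOn
    exact h.1.smooth.comp h1 fun p hp =>
      ⟨⟨by linarith [hp.1.2], by linarith [hp.1.1]⟩, mem_univ _⟩
  · simpa using h.2
  · exact fun t ht => h.1.cosymplectic (1 - t) ⟨by linarith [ht.2], by linarith [ht.1]⟩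
  · simpa using h.1.map_zero

theorem IsFluxForm.reverse {S : CosymplecticStructure n M} {Φ : ℝ → M → M}
    (hΦ : IsCosymplecticIsotopy S Φ) {α : DiffForm (2 * n + 1) M 1} (h : IsFluxForm S Φ α) :
    IsFluxForm S (fun t => Φ (1 - t)) (-α) := by
  intro x v
  have key : ∀ t ∈ Icc (0 : ℝ) 1,
      fluxIntegrand S (fun t => Φ (1 - t)) x v t = - fluxIntegrand S Φ x v (1 - t) := by
    intro t ht
    rw [fluxIntegrand_reparam hΦ (a := fun s => 1 - s) (a' := -1) ht
      (by simpa using (hasDerivAt_id t).const_sub 1)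
      (fun s hs => ⟨by linarith [hs.2], by linarith [hs.1]⟩) (Filter.Eventually.of_forall
        fun s => rfl)]
    ring
  obtain ⟨hi, he⟩ := h x v
  have hi' : IntervalIntegrable (fun t => - fluxIntegrand S Φ x v (1 - t))
      MeasureTheory.volume 0 1 := by
    have := (hi.comp_sub_left 1).neg.symm
    simpa [Pi.neg_def] using this
  have hcongr : EqOn (fun t => - fluxIntegrand S Φ x v (1 - t))
      (fluxIntegrand S (fun t => Φ (1 - t)) x v) (uIcc 0 1) := fun t ht => by
    rw [uIcc_of_le zero_le_one] at ht
    exact (key t ht).symm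
  refine ⟨hi'.congr fun t ht => hcongr (uIoc_subset_uIcc ht), ?_⟩
  rw [← intervalIntegral.integral_congr hcongr, intervalIntegral.integral_neg,
    intervalIntegral.integral_comp_sub_left (fun t => fluxIntegrand S Φ x v t) 1]
  simp only [sub_self, sub_zero]
  rw [← he]; rfl

/-- The concatenation of two loops, reparametrized so as to be smooth: first `Φ`, then `Ψ`. -/
noncomputable def concatLoop {M : Type*} (Φ Ψ : ℝ → M → M) (t : ℝ) : M → M :=
  Ψ (Real.smoothTransition (2 * t - 1)) ∘ Φ (Real.smoothTransition (2 * t))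

theorem concatLoop_of_le {M : Type*} {Φ Ψ : ℝ → M → M} (hΨ : Ψ 0 = id) {t : ℝ} (ht : t ≤ 1 / 2) :
    concatLoop Φ Ψ t = Φ (Real.smoothTransition (2 * t)) := by
  rw [concatLoop, Real.smoothTransition.zero_of_nonpos (by linarith), hΨ, Function.id_comp]

theorem concatLoop_of_ge {M : Type*} {Φ Ψ : ℝ → M → M} (hΦ : Φ 1 = id) {t : ℝ} (ht : 1 / 2 ≤ t) :
    concatLoop Φ Ψ t = Ψ (Real.smoothTransition (2 * t - 1)) := by
  rw [concatLoop, Real.smoothTransition.one_of_one_le (x := 2 * t) (by linarith), hΦ, Function.comp_id]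

theorem IsCosymplecticLoop.concat {S : CosymplecticStructure n M} {Φ Ψ : ℝ → M → M}
    (hΦ : IsCosymplecticLoop S Φ) (hΨ : IsCosymplecticLoop S Ψ) :
    IsCosymplecticLoop S (concatLoop Φ Ψ) := by
  have hmem : ∀ s, Real.smoothTransition s ∈ Icc (0 : ℝ) 1 := fun s =>
    ⟨Real.smoothTransition.nonneg s, Real.smoothTransition.le_one s⟩
  have hs : ContDiff ℝ C∞ Real.smoothTransition := Real.smoothTransition.contDiff
  refine ⟨⟨?_, ?_, ?_⟩, ?_⟩
  · have a1 : ContMDiff (𝓘(ℝ, ℝ).prod (𝓡 (2 * n + 1))) 𝓘(ℝ, ℝ) C∞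
        (fun p : ℝ × M => Real.smoothTransition (2 * p.1)) :=
      (hs.comp (contDiff_const.mul contDiff_id)).contMDiff.comp contMDiff_fst
    have a2 : ContMDiff (𝓘(ℝ, ℝ).prod (𝓡 (2 * n + 1))) 𝓘(ℝ, ℝ) C∞
        (fun p : ℝ × M => Real.smoothTransition (2 * p.1 - 1)) :=
      (hs.comp ((contDiff_const.mul contDiff_id).sub contDiff_const)).contMDiff.comp contMDiff_fst
    have b1 := hΦ.1.smooth.comp (a1.prodMk contMDiff_snd).contMDiffOn
      (s := Icc 0 1 ×ˢ univ) fun p _ => ⟨hmem _, mem_univ _⟩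
    exact hΨ.1.smooth.comp (a2.contMDiffOn.prodMk b1) fun p _ => ⟨hmem _, mem_univ _⟩
  · rw [concatLoop_of_le hΨ.1.map_zero (by norm_num)]
    simpa using hΦ.1.map_zero
  · intro t _
    rcases le_total t (1 / 2) with h | h
    · rw [concatLoop_of_le hΨ.1.map_zero h]
      exact hΦ.1.cosymplectic _ (hmem _)
    · rw [concatLoop_of_ge hΦ.2 h]
      exact hΨ.1.cosymplectic _ (hmem _)
  · rw [concatLoop_of_ge hΦ.2 (by norm_num)]
    have : (2 * 1 - 1 : ℝ) = 1 := by norm_num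
    rw [this, Real.smoothTransition.one, hΨ.2]

theorem intervalIntegral_reparam {f g a a' : ℝ → ℝ} {p q : ℝ} (hpq : p ≤ q)
    (ha : ∀ t, HasDerivAt a (a' t) t) (hmono : Monotone a) (hp : a p = 0) (hq : a q = 1)
    (hfg : ∀ t ∈ Ioo p q, f t = a' t * g (a t))
    (hg : IntervalIntegrable g MeasureTheory.volume 0 1) :
    IntervalIntegrable f MeasureTheory.volume p q ∧ ∫ t in p..q, f t = ∫ t in (0 : ℝ)..1, g t := by
  have hc : ContinuousOn a (Icc p q) := fun t _ => (ha t).continuousAt.continuousWithinAt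
  have hd : ∀ t ∈ Ioo p q, HasDerivAt a (a' t) t := fun t _ => ha t
  have hn : ∀ t ∈ Ioo p q, 0 ≤ a' t := fun t _ => by
    rw [← (ha t).deriv]; exact hmono.deriv_nonneg
  rw [intervalIntegrable_iff_integrableOn_Icc_of_le zero_le_one] at hg
  have hI := (MeasureTheory.integrableOn_Icc_deriv_smul_iff_of_deriv_nonneg (g := g) hc hd hn hpq).2
    (by rwa [hp, hq])
  have hE := MeasureTheory.integral_Icc_deriv_smul_of_deriv_nonneg (g := g) hc hd hn hpq
  rw [hp, hq] at hE
  constructor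
  · rw [intervalIntegrable_iff_integrableOn_Ioo_of_le hpq]
    exact (hI.mono_set Ioo_subset_Icc_self).congr_fun (fun t ht => (hfg t ht).symm)
      measurableSet_Ioo
  · rw [intervalIntegral.integral_of_le hpq, intervalIntegral.integral_of_le zero_le_one,
      ← MeasureTheory.integral_Icc_eq_integral_Ioc, ← MeasureTheory.integral_Icc_eq_integral_Ioc,
      ← hE, MeasureTheory.integral_Icc_eq_integral_Ioo, MeasureTheory.integral_Icc_eq_integral_Ioo]
    exact MeasureTheory.setIntegral_congr_fun measurableSet_Ioo hfg

theorem IsFluxForm.concat {S : CosymplecticStructure n M} {Φ Ψ : ℝ → M → M}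
    (hΦ : IsCosymplecticLoop S Φ) (hΨ : IsCosymplecticLoop S Ψ)
    {α β : DiffForm (2 * n + 1) M 1} (hα : IsFluxForm S Φ α) (hβ : IsFluxForm S Ψ β) :
    IsFluxForm S (concatLoop Φ Ψ) (α + β) := by
  intro x v
  have hmem : ∀ s, Real.smoothTransition s ∈ Icc (0 : ℝ) 1 := fun s =>
    ⟨Real.smoothTransition.nonneg s, Real.smoothTransition.le_one s⟩
  have hd : ∀ s, HasDerivAt Real.smoothTransition (deriv Real.smoothTransition s) s := fun s =>
    ((Real.smoothTransition.contDiff (n := 1)).differentiable (by simp) s).hasDerivAt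
  have hd1 : ∀ t, HasDerivAt (fun t => Real.smoothTransition (2 * t))
      (deriv Real.smoothTransition (2 * t) * 2) t := fun t =>
    HasDerivAt.comp (h := fun t => 2 * t) t (hd (2 * t)) (by simpa using (hasDerivAt_id t).const_mul 2)
  have hd2 : ∀ t, HasDerivAt (fun t => Real.smoothTransition (2 * t - 1))
      (deriv Real.smoothTransition (2 * t - 1) * 2) t := fun t =>
    HasDerivAt.comp (h := fun t => 2 * t - 1) t (hd (2 * t - 1)) (by simpa using ((hasDerivAt_id t).const_mul 2).sub_const 1)
  have h1 := intervalIntegral_reparam (f := fluxIntegrand S (concatLoop Φ Ψ) x v)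
    (g := fluxIntegrand S Φ x v) (p := 0) (q := 1 / 2) (by norm_num) hd1
    (fun s t hst => Real.smoothTransition.monotone (by linarith)) (by simp) (by norm_num)
    (fun t ht => fluxIntegrand_reparam hΦ.1 ⟨ht.1.le, by linarith [ht.2]⟩ (hd1 t)
      (fun _ _ => hmem _)
      ((eventually_lt_nhds ht.2).mono fun s hs => concatLoop_of_le hΨ.1.map_zero (le_of_lt hs)) x v)
    (hα x v).1
  have h2 := intervalIntegral_reparam (f := fluxIntegrand S (concatLoop Φ Ψ) x v)
    (g := fluxIntegrand S Ψ x v) (p := 1 / 2) (q := 1) (by norm_num) hd2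
    (fun s t hst => Real.smoothTransition.monotone (by linarith)) (by norm_num) (by norm_num)
    (fun t ht => fluxIntegrand_reparam hΨ.1 ⟨by linarith [ht.1], ht.2.le⟩ (hd2 t)
      (fun _ _ => hmem _)
      ((eventually_gt_nhds ht.1).mono fun s hs => concatLoop_of_ge hΦ.2 (le_of_lt hs)) x v)
    (hβ x v).1
  refine ⟨h1.1.trans h2.1, ?_⟩
  rw [← intervalIntegral.integral_add_adjacent_intervals h1.1 h2.1, h1.2, h2.2, ← (hα x v).2,
    ← (hβ x v).2]
  rfl

/-- The flux group `Γ_{η,ω} ⊆ H¹_Reeb(M, ℝ)`: the image of the flux homomorphism on the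
fundamental group of the group of cosymplectomorphisms, that is, the set of the classes
`[∫₀¹ φ_t^* (ι_{X_t} ω + η(X_t) η) dt]` of all loops `(φ_t)` of cosymplectomorphisms based at
the identity. -/
def fluxGroup : AddSubgroup S.H1Reeb where
  carrier := {c | ∃ (Φ : ℝ → M → M) (α : S.C1Reeb),
    IsCosymplecticLoop S Φ ∧ IsFluxForm S Φ α ∧ S.classOf α = c}
  zero_mem' := ⟨fun _ => id, 0, isCosymplecticLoop_const S, isFluxForm_const S, rfl⟩
  add_mem' := by
    rintro _ _ ⟨Φ, α, h1, h2, rfl⟩ ⟨Ψ, β, h3, h4, rfl⟩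
    exact ⟨concatLoop Φ Ψ, α + β, h1.concat h3, h2.concat h1 h3 h4, rfl⟩
  neg_mem' := by
    rintro _ ⟨Φ, α, h1, h2, rfl⟩
    exact ⟨fun t => Φ (1 - t), -α, h1.reverse, h2.reverse h1.1, rfl⟩

end Flux

end CosymplecticStructure

/-! Everything attached to a cosymplectic manifold here is natural under pullback by a
diffeomorphism $\phi$ preserving $\eta$ and $\omega$; the proof verifies this naturality and applies
it to both $\phi$ and $\phi^{-1}$.

For the cohomology, pullback commutes with $d$ (`extD_pullback`, `pullback_dFun`) and preserves
smoothness of 1-forms (`IsSmooth.pullback`). Since $d\phi(\xi_1)$ satisfies the equations that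
characterise $\xi_2$, it equals $\xi_2$ along $\phi$ (`mfderiv_reeb`), so
$(\phi^*\alpha)(\xi_1)=\alpha(\xi_2)\circ\phi$. Local constancy and vanishing of the Reeb component
are thus preserved, and $\phi^*$ descends to the quotients.

For the flux, a loop $\Phi_t$ on $M_2$ is conjugated to $\phi^{-1}\circ\Phi_t\circ\phi$ on $M_1$.
Its velocities are the images of those of $\Phi_t$ under $d\phi^{-1}$, so the flux integrands agree
at every $t\in[0,1]$ (`fluxIntegrand_conjFamily`), and the flux form of the conjugated loop is the
pullback of the original one. Hence $\phi^*$ carries flux classes to flux classes, and so does its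
inverse. -/

namespace DiffForm

/-! ### Functoriality of the pullback of forms -/

section Pullback

variable {d e c : ℕ}
  {M : Type*} [TopologicalSpace M] [ChartedSpace (EuclideanSpace ℝ (Fin d)) M]
  {N : Type*} [TopologicalSpace N] [ChartedSpace (EuclideanSpace ℝ (Fin e)) N]
  {P : Type*} [TopologicalSpace P] [ChartedSpace (EuclideanSpace ℝ (Fin c)) P]

theorem pullback_apply {k : ℕ} (f : M → N) (α : DiffForm e N k) (x : M)
    (v : Fin k → TangentSpace (𝓡 d) x) :
    pullback f α x v = α (f x) fun i => mfderiv (𝓡 d) (𝓡 e) f x (v i) := rfl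

theorem pullback_zero {k : ℕ} (f : M → N) :
    (pullback f (0 : DiffForm e N k) : DiffForm d M k) = 0 := rfl

theorem pullback_id {k : ℕ} (α : DiffForm d M k) : pullback (id : M → M) α = α := by
  funext x
  ext v
  rw [pullback_apply, mfderiv_id]
  rfl

theorem pullback_congr {k : ℕ} {f g : M → N} {x : M} (h : f =ᶠ[𝓝 x] g) (α : DiffForm e N k) :
    (pullback f α : DiffForm d M k) x = pullback g α x := by
  -- The fibre containing `α (f x)` depends on `f x`, so base point and derivative cannot be
  -- rewritten separately. Generalising both, with tangent spaces read as the model space, allows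
  -- substitution.
  have key : ∀ (a b : N) (_ : a = b)
      (L L' : EuclideanSpace ℝ (Fin d) →L[ℝ] EuclideanSpace ℝ (Fin e)) (_ : L = L'),
      (α a).compContinuousLinearMap (M' := EuclideanSpace ℝ (Fin d)) L =
        (α b).compContinuousLinearMap (M' := EuclideanSpace ℝ (Fin d)) L' := by
    rintro a _ rfl L _ rfl
    rfl
  exact key _ _ h.self_of_nhds _ _ h.mfderiv_eq

theorem pullback_comp {k : ℕ} {f : M → N} {g : N → P} {x : M}
    (hg : MDifferentiableAt (𝓡 e) (𝓡 c) g (f x)) (hf : MDifferentiableAt (𝓡 d) (𝓡 e) f x)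
    (α : DiffForm c P k) :
    (pullback (g ∘ f) α : DiffForm d M k) x = pullback f (pullback g α : DiffForm e N k) x := by
  ext v
  rw [pullback_apply, mfderiv_comp x hg hf]
  rfl

/-- Makes `pullback_comp` available for computing with chart expressions. -/
theorem inChart_eq_pullback {k : ℕ} (α : DiffForm d M k) (x : M)
    (y : EuclideanSpace ℝ (Fin d)) :
    α.inChart x y =
      (pullback (extChartAt (𝓡 d) x).symm α : DiffForm d (EuclideanSpace ℝ (Fin d)) k) y := rfl

/-- The expression of a map in the preferred charts at `x` and at its image. -/
noncomputable def mapInCharts (d e : ℕ) {M N : Type*}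
    [TopologicalSpace M] [ChartedSpace (EuclideanSpace ℝ (Fin d)) M]
    [TopologicalSpace N] [ChartedSpace (EuclideanSpace ℝ (Fin e)) N] (f : M → N) (x : M) :
    EuclideanSpace ℝ (Fin d) → EuclideanSpace ℝ (Fin e) :=
  extChartAt (𝓡 e) (f x) ∘ f ∘ (extChartAt (𝓡 d) x).symm

theorem mapInCharts_extChartAt (f : M → N) (x : M) :
    mapInCharts d e f x (extChartAt (𝓡 d) x x) = extChartAt (𝓡 e) (f x) (f x) := by
  simp [mapInCharts]

theorem contDiffAt_mapInCharts {f : M → N} (hf : ContMDiff (𝓡 d) (𝓡 e) C∞ f) (x : M) :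
    ContDiffAt ℝ C∞ (mapInCharts d e f x) (extChartAt (𝓡 d) x x) := by
  have h := (contMDiffAt_iff.1 (hf x)).2
  -- There is no boundary: the model's range is the whole space, so smoothness within it is
  -- smoothness at the point.
  rwa [modelWithCornersSelf_coe, range_id, contDiffWithinAt_univ] at h

theorem pullback_dFun {f : M → N} (hf : ContMDiff (𝓡 d) (𝓡 e) C∞ f) {u : N → ℝ}
    (hu : ContMDiff (𝓡 e) 𝓘(ℝ, ℝ) C∞ u) :
    (pullback f (dFun u : DiffForm e N 1) : DiffForm d M 1) = dFun (u ∘ f) := by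
  funext x
  unfold dFun
  rw [mfderiv_comp x ((hu _).mdifferentiableAt (by simp)) ((hf x).mdifferentiableAt (by simp))]
  ext v
  rfl

theorem pullback_symm_pullback {k : ℕ} (φ : Diffeomorph (𝓡 d) (𝓡 e) M N C∞)
    (α : DiffForm e N k) :
    pullback φ.symm (pullback φ α : DiffForm d M k) = α := by
  funext y
  rw [← pullback_comp (φ.mdifferentiable (by simp) _) (φ.symm.mdifferentiable (by simp) y)]
  have : φ ∘ φ.symm = id := funext φ.apply_symm_apply
  rw [this, pullback_id]

theorem pullback_pullback_symm {k : ℕ} (φ : Diffeomorph (𝓡 d) (𝓡 e) M N C∞)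
    (α : DiffForm d M k) :
    pullback φ (pullback φ.symm α : DiffForm e N k) = α :=
  pullback_symm_pullback φ.symm α

/-! ### Pullback, smoothness and the exterior derivative, computed in charts -/

variable [IsManifold (𝓡 d) C∞ M] [IsManifold (𝓡 e) C∞ N]

/-- Near the centre of the chart, `f` after the inverse chart at `x` equals the inverse chart at `f
x` after `mapInCharts`; pulling `α` back along both factorisations gives the formula. It is only
local because `f` must land in the source of the chart at `f x`. -/
theorem inChart_pullback {k : ℕ} {f : M → N} (hf : ContMDiff (𝓡 d) (𝓡 e) C∞ f)
    (α : DiffForm e N k) (x : M) :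
    (pullback f α : DiffForm d M k).inChart x =ᶠ[𝓝 (extChartAt (𝓡 d) x x)]
      fun y => (α.inChart (f x) (mapInCharts d e f x y)).compContinuousLinearMap
        (fderiv ℝ (mapInCharts d e f x) y) := by
  have hsymm : ∀ y ∈ (extChartAt (𝓡 d) x).target,
      MDifferentiableAt (𝓡 d) (𝓡 d) (extChartAt (𝓡 d) x).symm y := fun y hy =>
    ((contMDiffOn_extChartAt_symm (n := C∞) x).contMDiffAt
      ((isOpen_extChartAt_target x).mem_nhds hy)).mdifferentiableAt (by simp)
  have hcont : ContinuousAt (f ∘ (extChartAt (𝓡 d) x).symm) (extChartAt (𝓡 d) x x) := by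
    refine ContinuousAt.comp ?_ (continuousAt_extChartAt_symm x)
    exact hf.continuous.continuousAt
  have hsource : ∀ᶠ y in 𝓝 (extChartAt (𝓡 d) x x),
      (f ∘ (extChartAt (𝓡 d) x).symm) y ∈ (extChartAt (𝓡 e) (f x)).source := by
    refine hcont.eventually_mem ?_
    simpa using extChartAt_source_mem_nhds (I := 𝓡 e) (f x)
  -- `eventually_nhds` is needed because comparing derivatives at `y` takes equality of the two maps
  -- on a neighbourhood of `y`.
  filter_upwards [extChartAt_target_mem_nhds (I := 𝓡 d) x, hsource.eventually_nhds] with y hy hs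
  have hfs : MDifferentiableAt (𝓡 d) (𝓡 e) f ((extChartAt (𝓡 d) x).symm y) :=
    (hf _).mdifferentiableAt (by simp)
  have hcomp : MDifferentiableAt (𝓡 d) (𝓡 e) (f ∘ (extChartAt (𝓡 d) x).symm) y :=
    hfs.comp y (hsymm y hy)
  have hchart : MDifferentiableAt (𝓡 e) (𝓡 e) (extChartAt (𝓡 e) (f x))
      ((f ∘ (extChartAt (𝓡 d) x).symm) y) :=
    mdifferentiableAt_extChartAt (by simpa using hs.self_of_nhds)
  have hg : MDifferentiableAt (𝓡 d) (𝓡 e) (mapInCharts d e f x) y := hchart.comp y hcomp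
  have hsymm' : MDifferentiableAt (𝓡 e) (𝓡 e) (extChartAt (𝓡 e) (f x)).symm
      (mapInCharts d e f x y) := by
    refine ((contMDiffOn_extChartAt_symm (n := C∞) (f x)).contMDiffAt
      ((isOpen_extChartAt_target (f x)).mem_nhds ?_)).mdifferentiableAt (by simp)
    exact (extChartAt (𝓡 e) (f x)).map_source hs.self_of_nhds
  have heq : f ∘ (extChartAt (𝓡 d) x).symm =ᶠ[𝓝 y]
      (extChartAt (𝓡 e) (f x)).symm ∘ mapInCharts d e f x :=
    hs.mono fun z hz => ((extChartAt (𝓡 e) (f x)).left_inv hz).symm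
  rw [inChart_eq_pullback, ← pullback_comp hfs (hsymm y hy), pullback_congr heq,
    pullback_comp hsymm' hg, ← mfderiv_eq_fderiv]
  rfl

/-- In coordinates a pulled-back 1-form is a smooth family of functionals composed with the smooth
family of derivatives of `f`. Degree one is all that `C1Reeb` requires. -/
theorem IsSmooth.pullback {f : M → N} (hf : ContMDiff (𝓡 d) (𝓡 e) C∞ f) {α : DiffForm e N 1}
    (hα : α.IsSmooth) : (DiffForm.pullback f α : DiffForm d M 1).IsSmooth := by
  intro x
  refine ContDiffAt.congr_of_eventuallyEq ?_ (inChart_pullback hf α x)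
  have hg := contDiffAt_mapInCharts hf x
  have h1 : ContDiffAt ℝ C∞ (fun y => α.inChart (f x) (mapInCharts d e f x y))
      (extChartAt (𝓡 d) x x) := by
    have := hα (f x)
    rw [← mapInCharts_extChartAt (d := d)] at this
    exact this.comp _ hg
  have h2 : ContDiffAt ℝ C∞ (fderiv ℝ (mapInCharts d e f x)) (extChartAt (𝓡 d) x x) :=
    hg.fderiv_right (m := C∞) (by simp)
  -- `T` and `T'` identify alternating 1-forms with continuous functionals, turning the pullback
  -- into a composition of continuous linear maps, which is smooth in both factors.
  let T := ContinuousAlternatingMap.ofSubsingletonLIE (𝕜 := ℝ)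
    (E := EuclideanSpace ℝ (Fin e)) (F := ℝ) (0 : Fin 1)
  let T' := ContinuousAlternatingMap.ofSubsingletonLIE (𝕜 := ℝ)
    (E := EuclideanSpace ℝ (Fin d)) (F := ℝ) (0 : Fin 1)
  have h3 : ContDiffAt ℝ C∞ (fun y => T'
      ((T.symm (α.inChart (f x) (mapInCharts d e f x y))).comp (fderiv ℝ (mapInCharts d e f x) y)))
      (extChartAt (𝓡 d) x x) :=
    T'.contDiff.contDiffAt.comp _ ((T.symm.contDiff.contDiffAt.comp _ h1).clm_comp h2)
  refine h3.congr_of_eventuallyEq (Filter.Eventually.of_forall fun y => ?_)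
  ext v
  exact congrArg (α.inChart (f x) (mapInCharts d e f x y))
    (funext fun i => by rw [Subsingleton.elim i 0])

/-- The Euclidean identity `extDeriv_pullback`, applied to the coordinate expression of `f`, is
carried back to the manifolds by the chain rule for `mapInCharts` composed with the chart at `x`. -/
theorem extD_pullback {k : ℕ} {f : M → N} (hf : ContMDiff (𝓡 d) (𝓡 e) C∞ f) {α : DiffForm e N k}
    (hα : α.IsSmooth) :
    (pullback f α : DiffForm d M k).extD = pullback f α.extD := by
  funext x
  have hg := contDiffAt_mapInCharts hf x
  have hα' : DifferentiableAt ℝ (α.inChart (f x))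
      (mapInCharts d e f x (extChartAt (𝓡 d) x x)) := by
    rw [mapInCharts_extChartAt]
    exact (hα (f x)).differentiableAt (by simp)
  have hd : extDeriv ((pullback f α : DiffForm d M k).inChart x) (extChartAt (𝓡 d) x x) =
      (extDeriv (α.inChart (f x))
        (mapInCharts d e f x (extChartAt (𝓡 d) x x))).compContinuousLinearMap
          (fderiv ℝ (mapInCharts d e f x) (extChartAt (𝓡 d) x x)) :=
    ((inChart_pullback hf α x).extDeriv_eq).trans
      (extDeriv_pullback hα' hg (by simpa using WithTop.coe_le_coe.2 (le_top (a := (2 : ℕ∞)))))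
  have hchart : MDifferentiableAt (𝓡 d) (𝓡 d) (extChartAt (𝓡 d) x) x :=
    mdifferentiableAt_extChartAt (mem_chart_source _ x)
  have hchart' : MDifferentiableAt (𝓡 e) (𝓡 e) (extChartAt (𝓡 e) (f x)) (f x) :=
    mdifferentiableAt_extChartAt (mem_chart_source _ (f x))
  have hg' : MDifferentiableAt (𝓡 d) (𝓡 e) (mapInCharts d e f x) (extChartAt (𝓡 d) x x) :=
    (hg.differentiableAt (by simp)).mdifferentiableAt
  have heq : mapInCharts d e f x ∘ extChartAt (𝓡 d) x =ᶠ[𝓝 x] extChartAt (𝓡 e) (f x) ∘ f := by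
    filter_upwards [extChartAt_source_mem_nhds (I := 𝓡 d) x] with z hz
    simp only [mapInCharts, Function.comp_apply, (extChartAt (𝓡 d) x).left_inv hz]
  -- Viewed as a form on Euclidean space, `β` pulled back by the chart at `f x` has value `α.extD (f
  -- x)` at that point. Thus `h1` compares the pullbacks of `β` along the two sides of `heq`.
  let β : DiffForm e (EuclideanSpace ℝ (Fin e)) (k + 1) := extDeriv (α.inChart (f x))
  have h1 := pullback_comp hg' hchart β
  rw [pullback_congr heq, pullback_comp hchart' ((hf x).mdifferentiableAt (by simp))] at h1
  refine Eq.trans ?_ h1.symm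
  ext v
  have := congrArg (fun A : EuclideanSpace ℝ (Fin d) [⋀^Fin (k + 1)]→L[ℝ] ℝ =>
    A fun i => mfderiv (𝓡 d) 𝓘(ℝ, EuclideanSpace ℝ (Fin d)) (extChartAt (𝓡 d) x) x (v i)) hd
  refine this.trans ?_
  rw [← mfderiv_eq_fderiv]
  rfl

end Pullback

end DiffForm

namespace CosymplecticStructure

/-! ### Naturality of the Reeb field and of the Reeb cohomology -/

section Functoriality

variable {n₁ n₂ : ℕ} {M₁ M₂ : Type*}
  [TopologicalSpace M₁] [ChartedSpace (EuclideanSpace ℝ (Fin (2 * n₁ + 1))) M₁]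
  [IsManifold (𝓡 (2 * n₁ + 1)) C∞ M₁]
  [TopologicalSpace M₂] [ChartedSpace (EuclideanSpace ℝ (Fin (2 * n₂ + 1))) M₂]
  [IsManifold (𝓡 (2 * n₂ + 1)) C∞ M₂]
  {S₁ : CosymplecticStructure n₁ M₁} {S₂ : CosymplecticStructure n₂ M₂}
  {φ : Diffeomorph (𝓡 (2 * n₁ + 1)) (𝓡 (2 * n₂ + 1)) M₁ M₂ C∞}

theorem IsCosymplectomorphism.symm (h : IsCosymplectomorphism S₁ S₂ φ) :
    IsCosymplectomorphism S₂ S₁ φ.symm := by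
  constructor
  · rw [← h.1, DiffForm.pullback_symm_pullback]
  · rw [← h.2, DiffForm.pullback_symm_pullback]

theorem IsCosymplectomorphism.η_apply (h : IsCosymplectomorphism S₁ S₂ φ) (x : M₁)
    (v : TangentSpace (𝓡 (2 * n₁ + 1)) x) :
    S₂.η (φ x) (fun _ => mfderiv (𝓡 (2 * n₁ + 1)) (𝓡 (2 * n₂ + 1)) φ x v) =
      S₁.η x (fun _ => v) := by
  rw [← h.1]; rfl

theorem IsCosymplectomorphism.ω_apply (h : IsCosymplectomorphism S₁ S₂ φ) (x : M₁)
    (v w : TangentSpace (𝓡 (2 * n₁ + 1)) x) :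
    S₂.ω (φ x) ![mfderiv (𝓡 (2 * n₁ + 1)) (𝓡 (2 * n₂ + 1)) φ x v,
      mfderiv (𝓡 (2 * n₁ + 1)) (𝓡 (2 * n₂ + 1)) φ x w] = S₁.ω x ![v, w] := by
  rw [← h.2, DiffForm.pullback_apply]
  congr 1
  ext i
  fin_cases i <;> rfl

/-- The image vector satisfies both defining equations of the Reeb vector at `φ x`, which has only
one solution. -/
theorem IsCosymplectomorphism.mfderiv_reeb (h : IsCosymplectomorphism S₁ S₂ φ) (x : M₁) :
    mfderiv (𝓡 (2 * n₁ + 1)) (𝓡 (2 * n₂ + 1)) φ x (S₁.reeb x) = S₂.reeb (φ x) := by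
  refine S₂.eq_reeb ?_ fun w => ?_
  · rw [h.η_apply, (S₁.reeb_spec x).1]
  -- Preservation of `ω` only speaks of images under the differential; its surjectivity makes these
  -- all the test vectors.
  · obtain ⟨w, rfl⟩ := (φ.mfderivToContinuousLinearEquiv (by simp) x).surjective w
    exact (h.ω_apply x _ w).trans ((S₁.reeb_spec x).2 w)

theorem IsCosymplectomorphism.pullback_reeb (h : IsCosymplectomorphism S₁ S₂ φ)
    (α : DiffForm (2 * n₂ + 1) M₂ 1) (x : M₁) :
    (DiffForm.pullback φ α : DiffForm (2 * n₁ + 1) M₁ 1) x (fun _ => S₁.reeb x) =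
      α (φ x) fun _ => S₂.reeb (φ x) := by
  rw [DiffForm.pullback_apply, h.mfderiv_reeb]

theorem IsCosymplectomorphism.pullback_mem_C1Reeb (h : IsCosymplectomorphism S₁ S₂ φ)
    {α : DiffForm (2 * n₂ + 1) M₂ 1} (hα : α ∈ S₂.C1Reeb) :
    (DiffForm.pullback φ α : DiffForm (2 * n₁ + 1) M₁ 1) ∈ S₁.C1Reeb := by
  refine ⟨hα.1.pullback φ.contMDiff, ?_, ?_⟩
  · rw [DiffForm.extD_pullback φ.contMDiff hα.1, hα.2.1, DiffForm.pullback_zero]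
  · simp_rw [h.pullback_reeb]
    exact hα.2.2.comp_continuous φ.continuous

/-- Applying `pullback_reeb` to $df$ gives $\xi_1(f\circ\phi)=\xi_2(f)\circ\phi$, and local
constancy survives composition with a continuous map. -/
theorem IsCosymplectomorphism.comp_mem_C0Reeb (h : IsCosymplectomorphism S₁ S₂ φ)
    {f : M₂ → ℝ} (hf : f ∈ S₂.C0Reeb) : f ∘ φ ∈ S₁.C0Reeb := by
  refine ⟨hf.1.comp φ.contMDiff, ?_⟩
  rw [← DiffForm.pullback_dFun φ.contMDiff hf.1]
  simp_rw [h.pullback_reeb]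
  exact hf.2.comp_continuous φ.continuous

/-- The pullback of closed `1`-forms with constant Reeb component by a cosymplectomorphism. -/
noncomputable def IsCosymplectomorphism.pullbackC1 (h : IsCosymplectomorphism S₁ S₂ φ) :
    S₂.C1Reeb ≃ₗ[ℝ] S₁.C1Reeb where
  toFun α := ⟨DiffForm.pullback φ (α : DiffForm (2 * n₂ + 1) M₂ 1), h.pullback_mem_C1Reeb α.2⟩
  invFun α :=
    ⟨DiffForm.pullback φ.symm (α : DiffForm (2 * n₁ + 1) M₁ 1), h.symm.pullback_mem_C1Reeb α.2⟩
  map_add' _ _ := rfl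
  map_smul' _ _ := rfl
  left_inv _ := Subtype.ext (DiffForm.pullback_symm_pullback φ _)
  right_inv _ := Subtype.ext (DiffForm.pullback_pullback_symm φ _)

theorem IsCosymplectomorphism.pullbackC1_mem_B1Reeb (h : IsCosymplectomorphism S₁ S₂ φ)
    {α : S₂.C1Reeb} (hα : α ∈ S₂.B1Reeb) : h.pullbackC1 α ∈ S₁.B1Reeb := by
  obtain ⟨f, hf⟩ := hα
  refine ⟨⟨f ∘ φ, h.comp_mem_C0Reeb f.2⟩, ?_⟩
  change DiffForm.dFun ((f : M₂ → ℝ) ∘ φ) =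
    DiffForm.pullback φ (α : DiffForm (2 * n₂ + 1) M₂ 1)
  rw [← DiffForm.pullback_dFun φ.contMDiff f.2.1]
  exact congrArg (DiffForm.pullback φ) hf

theorem IsCosymplectomorphism.map_B1Reeb (h : IsCosymplectomorphism S₁ S₂ φ) :
    S₂.B1Reeb.map (h.pullbackC1 : S₂.C1Reeb →ₗ[ℝ] S₁.C1Reeb) = S₁.B1Reeb := by
  refine le_antisymm (Submodule.map_le_iff_le_comap.2 fun α hα => h.pullbackC1_mem_B1Reeb hα)
    fun α hα => ⟨h.pullbackC1.symm α, ?_, h.pullbackC1.apply_symm_apply α⟩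
  -- The reverse inclusion is the forward one for the inverse cosymplectomorphism.
  exact h.symm.pullbackC1_mem_B1Reeb hα

/-- The isomorphism of Reeb cohomologies induced by a cosymplectomorphism. -/
noncomputable def IsCosymplectomorphism.pullbackH1 (h : IsCosymplectomorphism S₁ S₂ φ) :
    S₂.H1Reeb ≃ₗ[ℝ] S₁.H1Reeb :=
  Submodule.Quotient.equiv _ _ h.pullbackC1 h.map_B1Reeb

theorem IsCosymplectomorphism.pullbackH1_classOf (h : IsCosymplectomorphism S₁ S₂ φ)
    (α : S₂.C1Reeb) : h.pullbackH1 (S₂.classOf α) = S₁.classOf (h.pullbackC1 α) := rfl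

/-- Used for `h` and for `h.symm`, this supplies both inverse laws of the flux group isomorphism. -/
theorem IsCosymplectomorphism.pullbackH1_symm_apply (h : IsCosymplectomorphism S₁ S₂ φ)
    (c : S₁.H1Reeb) : h.pullbackH1 (h.symm.pullbackH1 c) = c := by
  obtain ⟨α, rfl⟩ := Submodule.Quotient.mk_surjective _ c
  exact congrArg S₁.classOf (h.pullbackC1.apply_symm_apply α)

theorem IsCosymplectomorphism.pullbackH1_mem_horizontal (h : IsCosymplectomorphism S₁ S₂ φ)
    {c : S₂.H1Reeb} (hc : c ∈ S₂.H1ReebHorizontal) : h.pullbackH1 c ∈ S₁.H1ReebHorizontal := by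
  obtain ⟨α, hα, rfl⟩ := hc
  exact ⟨h.pullbackC1 α, fun x => (h.pullback_reeb _ x).trans (hα (φ x)), rfl⟩

theorem IsCosymplectomorphism.map_horizontal (h : IsCosymplectomorphism S₁ S₂ φ) :
    S₂.H1ReebHorizontal.map (h.pullbackH1 : S₂.H1Reeb →ₗ[ℝ] S₁.H1Reeb) = S₁.H1ReebHorizontal :=
  le_antisymm (Submodule.map_le_iff_le_comap.2 fun _ hc => h.pullbackH1_mem_horizontal hc)
    fun c hc => ⟨h.symm.pullbackH1 c, h.symm.pullbackH1_mem_horizontal hc,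
      h.pullbackH1_symm_apply c⟩

/-! ### Conjugation of isotopies and naturality of the flux -/

/-- The conjugate `φ⁻¹ ∘ Φ_t ∘ φ` of a family of self-maps by a diffeomorphism. -/
noncomputable def conjFamily (φ : Diffeomorph (𝓡 (2 * n₁ + 1)) (𝓡 (2 * n₂ + 1)) M₁ M₂ C∞)
    (Φ : ℝ → M₂ → M₂) (t : ℝ) : M₁ → M₁ :=
  φ.symm ∘ Φ t ∘ φ

theorem IsCosymplectomorphism.trans {n₃ : ℕ} {M₃ : Type*} [TopologicalSpace M₃]
    [ChartedSpace (EuclideanSpace ℝ (Fin (2 * n₃ + 1))) M₃] [IsManifold (𝓡 (2 * n₃ + 1)) C∞ M₃]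
    {S₃ : CosymplecticStructure n₃ M₃}
    {ψ : Diffeomorph (𝓡 (2 * n₂ + 1)) (𝓡 (2 * n₃ + 1)) M₂ M₃ C∞}
    (h : IsCosymplectomorphism S₁ S₂ φ) (h' : IsCosymplectomorphism S₂ S₃ ψ) :
    IsCosymplectomorphism S₁ S₃ (φ.trans ψ) := by
  constructor
  · funext x
    rw [Diffeomorph.coe_trans, DiffForm.pullback_comp (ψ.mdifferentiable (by simp) _)
      (φ.mdifferentiable (by simp) x), h'.1, h.1]
  · funext x
    rw [Diffeomorph.coe_trans, DiffForm.pullback_comp (ψ.mdifferentiable (by simp) _)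
      (φ.mdifferentiable (by simp) x), h'.2, h.2]

theorem IsCosymplectomorphism.conj_isotopy (h : IsCosymplectomorphism S₁ S₂ φ)
    {Φ : ℝ → M₂ → M₂} (hΦ : IsCosymplecticIsotopy S₂ Φ) :
    IsCosymplecticIsotopy S₁ (conjFamily φ Φ) := by
  refine ⟨?_, ?_, fun t ht => ?_⟩
  · have h1 : ContMDiffOn (𝓘(ℝ, ℝ).prod (𝓡 (2 * n₁ + 1))) (𝓘(ℝ, ℝ).prod (𝓡 (2 * n₂ + 1))) C∞
        (fun p : ℝ × M₁ => (p.1, φ p.2)) (Icc 0 1 ×ˢ univ) :=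
      (contMDiff_fst.prodMk (φ.contMDiff.comp contMDiff_snd)).contMDiffOn
    exact φ.symm.contMDiff.comp_contMDiffOn
      (hΦ.smooth.comp h1 fun p hp => ⟨hp.1, mem_univ _⟩)
  · funext x
    simp [conjFamily, hΦ.map_zero]
  · obtain ⟨ψ, hψ, hc⟩ := hΦ.cosymplectic t ht
    exact ⟨(φ.trans ψ).trans φ.symm, by rw [Diffeomorph.coe_trans, Diffeomorph.coe_trans, hψ]; rfl,
      (h.trans hc).trans h.symm⟩

theorem IsCosymplectomorphism.conj_loop (h : IsCosymplectomorphism S₁ S₂ φ)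
    {Φ : ℝ → M₂ → M₂} (hΦ : IsCosymplecticLoop S₂ Φ) :
    IsCosymplecticLoop S₁ (conjFamily φ Φ) := by
  refine ⟨h.conj_isotopy hΦ.1, ?_⟩
  funext x
  simp [conjFamily, hΦ.2]

/-- Chain rule for the curve $s\mapsto\Phi_s(\phi(x))$ followed by $\phi^{-1}$. Derivatives are
taken within $[0,1]$, where they are unique even at the endpoints. -/
theorem isotopyVelocity_conjFamily {Φ : ℝ → M₂ → M₂} (hΦ : IsCosymplecticIsotopy S₂ Φ) (x : M₁)
    {t : ℝ} (ht : t ∈ Icc (0 : ℝ) 1) :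
    isotopyVelocity (conjFamily φ Φ) t x =
      mfderiv (𝓡 (2 * n₂ + 1)) (𝓡 (2 * n₁ + 1)) φ.symm (Φ t (φ x))
        (isotopyVelocity Φ t (φ x)) := by
  have hu : UniqueMDiffWithinAt 𝓘(ℝ, ℝ) (Icc (0 : ℝ) 1) t :=
    (uniqueDiffOn_Icc (zero_lt_one' ℝ) t ht).uniqueMDiffWithinAt
  have h := mfderiv_comp_mfderivWithin t (φ.symm.mdifferentiable (by simp) (Φ t (φ x)))
    (hΦ.mdifferentiableWithinAt (φ x) ht) hu
  exact congrArg (fun L : ℝ →L[ℝ] EuclideanSpace ℝ (Fin (2 * n₁ + 1)) => L 1) h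

/-- Every vector fed to `ω` and `η` on the left is the image under $d\phi^{-1}$ of its counterpart
on the right, and $\phi^{-1}$ preserves both forms. -/
theorem IsCosymplectomorphism.fluxIntegrand_conjFamily (h : IsCosymplectomorphism S₁ S₂ φ)
    {Φ : ℝ → M₂ → M₂} (hΦ : IsCosymplecticIsotopy S₂ Φ) (x : M₁)
    (v : TangentSpace (𝓡 (2 * n₁ + 1)) x) {t : ℝ} (ht : t ∈ Icc (0 : ℝ) 1) :
    fluxIntegrand S₁ (conjFamily φ Φ) x v t =
      fluxIntegrand S₂ Φ (φ x) (mfderiv (𝓡 (2 * n₁ + 1)) (𝓡 (2 * n₂ + 1)) φ x v) t := by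
  -- Differentiability of the single map `Φ t` is read off the diffeomorphism equal to it.
  obtain ⟨ψ, hψ, -⟩ := hΦ.cosymplectic t ht
  have hd : MDifferentiableAt (𝓡 (2 * n₂ + 1)) (𝓡 (2 * n₂ + 1)) (Φ t) (φ x) :=
    hψ ▸ ψ.mdifferentiable (by simp) (φ x)
  have hφ : MDifferentiableAt (𝓡 (2 * n₁ + 1)) (𝓡 (2 * n₂ + 1)) φ x :=
    φ.mdifferentiable (by simp) x
  have hv : mfderiv (𝓡 (2 * n₁ + 1)) (𝓡 (2 * n₁ + 1)) (conjFamily φ Φ t) x v =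
      mfderiv (𝓡 (2 * n₂ + 1)) (𝓡 (2 * n₁ + 1)) φ.symm (Φ t (φ x))
        (mfderiv (𝓡 (2 * n₂ + 1)) (𝓡 (2 * n₂ + 1)) (Φ t) (φ x)
          (mfderiv (𝓡 (2 * n₁ + 1)) (𝓡 (2 * n₂ + 1)) φ x v)) := by
    rw [← mfderiv_comp_apply x hd hφ]
    exact mfderiv_comp_apply x (φ.symm.mdifferentiable (by simp) (Φ t (φ x))) (hd.comp x hφ) v
  rw [fluxIntegrand, hv, isotopyVelocity_conjFamily hΦ x ht]
  exact congrArg₂ (· + ·) (h.symm.ω_apply _ _ _)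
    (congrArg₂ (· * ·) (h.symm.η_apply _ _) (h.symm.η_apply _ _))

/-- The integrands coincide for each time in $[0,1]$, so integrability and the value of the integral
transfer at once. The equality holds for the forms themselves, before passing to classes. -/
theorem IsCosymplectomorphism.isFluxForm_pullback (h : IsCosymplectomorphism S₁ S₂ φ)
    {Φ : ℝ → M₂ → M₂} (hΦ : IsCosymplecticIsotopy S₂ Φ) {α : DiffForm (2 * n₂ + 1) M₂ 1}
    (hα : IsFluxForm S₂ Φ α) :
    IsFluxForm S₁ (conjFamily φ Φ) (DiffForm.pullback φ α) := by
  intro x v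
  obtain ⟨hi, he⟩ := hα (φ x) (mfderiv (𝓡 (2 * n₁ + 1)) (𝓡 (2 * n₂ + 1)) φ x v)
  have hcongr : EqOn
      (fluxIntegrand S₂ Φ (φ x) (mfderiv (𝓡 (2 * n₁ + 1)) (𝓡 (2 * n₂ + 1)) φ x v))
      (fluxIntegrand S₁ (conjFamily φ Φ) x v) (uIcc 0 1) := fun t ht => by
    rw [uIcc_of_le zero_le_one] at ht
    exact (h.fluxIntegrand_conjFamily hΦ x v ht).symm
  refine ⟨hi.congr fun t ht => hcongr (uIoc_subset_uIcc ht), ?_⟩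
  rw [← intervalIntegral.integral_congr hcongr, ← he]
  rfl

theorem IsCosymplectomorphism.pullbackH1_mem_fluxGroup (h : IsCosymplectomorphism S₁ S₂ φ)
    {c : S₂.H1Reeb} (hc : c ∈ S₂.fluxGroup) : h.pullbackH1 c ∈ S₁.fluxGroup := by
  obtain ⟨Φ, α, h1, h2, rfl⟩ := hc
  exact ⟨conjFamily φ Φ, h.pullbackC1 α, h.conj_loop h1, h.isFluxForm_pullback h1.1 h2, rfl⟩

/-- The isomorphism of flux groups induced by a cosymplectomorphism. -/
noncomputable def IsCosymplectomorphism.fluxGroupEquiv (h : IsCosymplectomorphism S₁ S₂ φ) :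
    S₂.fluxGroup ≃+ S₁.fluxGroup where
  toFun c := ⟨h.pullbackH1 c, h.pullbackH1_mem_fluxGroup c.2⟩
  invFun c := ⟨h.symm.pullbackH1 c, h.symm.pullbackH1_mem_fluxGroup c.2⟩
  left_inv c := Subtype.ext (h.symm.pullbackH1_symm_apply c)
  right_inv c := Subtype.ext (h.pullbackH1_symm_apply c)
  map_add' _ _ := Subtype.ext (map_add h.pullbackH1 _ _)

end Functoriality

end CosymplecticStructure

theorem proposition5p2 {n₁ n₂ : ℕ} {M₁ M₂ : Type*}
    [TopologicalSpace M₁] [ChartedSpace (EuclideanSpace ℝ (Fin (2 * n₁ + 1))) M₁]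
    [IsManifold (𝓡 (2 * n₁ + 1)) C∞ M₁]
    [TopologicalSpace M₂] [ChartedSpace (EuclideanSpace ℝ (Fin (2 * n₂ + 1))) M₂]
    [IsManifold (𝓡 (2 * n₂ + 1)) C∞ M₂]
    (S₁ : CosymplecticStructure n₁ M₁) (S₂ : CosymplecticStructure n₂ M₂) :
    -- every cosymplectomorphism `φ` induces an isomorphism `φ^*` of Reeb cohomologies, given on
    -- classes by `[α] ↦ [φ^* α]`, which restricts to an isomorphism of the flux groups
    (∀ φ : Diffeomorph (𝓡 (2 * n₁ + 1)) (𝓡 (2 * n₂ + 1)) M₁ M₂ C∞,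
      CosymplecticStructure.IsCosymplectomorphism S₁ S₂ φ →
      ∃ φstar : S₂.H1Reeb ≃ₗ[ℝ] S₁.H1Reeb,
        (∀ α : S₂.C1Reeb, ∃ h : DiffForm.pullback φ (α : DiffForm (2 * n₂ + 1) M₂ 1) ∈ S₁.C1Reeb,
          φstar (S₂.classOf α) = S₁.classOf ⟨_, h⟩) ∧
        Submodule.map (φstar : S₂.H1Reeb →ₗ[ℝ] S₁.H1Reeb) S₂.H1ReebHorizontal =
          S₁.H1ReebHorizontal ∧
        ∃ e : S₂.fluxGroup ≃+ S₁.fluxGroup,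
          ∀ c : S₂.fluxGroup, (e c : S₁.H1Reeb) = φstar (c : S₂.H1Reeb)) ∧
    -- non-isomorphic flux groups obstruct the existence of a cosymplectomorphism
    (IsEmpty (S₁.fluxGroup ≃+ S₂.fluxGroup) →
      ¬ ∃ φ : Diffeomorph (𝓡 (2 * n₁ + 1)) (𝓡 (2 * n₂ + 1)) M₁ M₂ C∞,
        CosymplecticStructure.IsCosymplectomorphism S₁ S₂ φ) := by
  refine ⟨fun φ h => ⟨h.pullbackH1, fun α => ⟨h.pullback_mem_C1Reeb α.2, h.pullbackH1_classOf α⟩,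
    h.map_horizontal, h.fluxGroupEquiv, fun _ => rfl⟩, ?_⟩
  rintro hempty ⟨φ, h⟩
  -- The pullback runs from the flux group of `S₂` to that of `S₁`, so it is inverted to contradict
  -- `hempty`.
  exact hempty.false h.fluxGroupEquiv.symm
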